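/- Let $R$ be a commutative ring with unit. A naive-cellular algebra over $R$ is an associative unital $R$-algebra $A$ with the following datum $(\Lambda, G, M, C, *)$: a poset $\Lambda$; for each $\lambda\in\Lambda$ a group $G(\lambda)$ and a finite set $M(\lambda)$ (the link states of type $\lambda$); elements $C^\sigma_{p,q}\in A$ for $\lambda\in\Lambda$, $p,q\in M(\lambda)$, $\sigma\in G(\lambda)$; and a map $*:A\to A$, such that (W1) the map $(p,\sigma,q)\mapsto C^\sigma_{p,q}$ from $\coprod_{\lambda} M(\lambda)\times G(\lambda)\times M(\lambda)$ to $A$ is injective and its image is an $R$-basis of $A$; (W2) $*$ is an $R$-linear anti-involution with $(C^{\sigma}_{p,q})^*=C^{\sigma^{-1}}_{q,p}$; (W3) for all $\lambda\in\Lambda$, $a\in A$, $\sigma\in G(\lambda)$ and $p,q\in M(\lambda)$, $$a\,C^\sigma_{p,q}\equiv\sum_{\sigma'\in G(\lambda),\;p'\in M(\lambda)} r_a(p',\sigma'\sigma^{-1},p)\,C^{\sigma'}_{p',q}\pmod{I_{<\lambda}},$$ with coefficients in $R$ depending only on $a,p',p$ and $\sigma'\sigma^{-1}$, only finitely many of which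 are nonzero in each sum. Here, for $X\subset\Lambda$, $I_X$ denotes the $R$-span of all $C^\sigma_{p,q}$ with $\sigma\in G(\mu)$, $p,q\in M(\mu)$, $\mu\in X$, and $I_{<\lambda}=I_{\{\mu\,\mid\,\mu<\lambda\}}$. If $X$ is downward closed (that is, $\mu\le\lambda\in X$ implies $\mu\in X$), then $I_X$ is a two-sided ideal of $A$. For $\lambda\in\Lambda$ the link module $W(\lambda)$ is, as an $R$-module, free on symbols $C_p$, $p\in M(\lambda)$. For $\tau\in G(\lambda)$ let $\langle\ ,\ \rangle_\tau$ be the $R$-bilinear form on $W(\lambda)$ with $$\langle C_q,C_p\rangle_\tau=r_{C^{1}_{p_1,q}}(p_1,\tau,p),$$ which does not depend on the choice of $p_1\in M(\lambda)$. **Theorem.** Let $A$ be a naive-cellular algebra over $R$ with datum $(\Lambda,G,M,C,*)$. Let $Y\subset X$ be downward closed subsets of $\Lambda$ with $X\setminus Y$ finite. Suppose that for each $\lambda\in X\setminus Y$ and every $q\in M(\lambda)$ there exist $v\in W(\lambda)$ and $\sigma\in G(\lambda)$ such that, for all $\tau\in G(\lambda)$, $$\langle C_q,v\rangle_\tau=\begin{cases}1&\text{if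 }\tau=\sigma,\\0&\text{otherwise.}\end{cases}$$ Then for any right $A$-module $M$ and left $A$-module $N$ on both of which $I_X$ acts trivially, and for every $n\ge 0$, there is an isomorphism of $R$-modules $$\mathrm{Tor}_n^{A/I_Y}(M,N)\cong\mathrm{Tor}_n^{A/I_X}(M,N).$$ -/

import Mathlib

open CategoryTheory TensorProduct MulOpposite

universe uR uB uM v uA uΛ uG uS

noncomputable section

/-! ### Tensor products and Tor over a noncommutative algebra -/

section BalancedTensor

variable (R : Type uR) [CommRing R] (B : Type uB) [Ring B] [Algebra R B]
variable (M : Type uM) [AddCommGroup M] [Module R M] [Module Bᵐᵒᵖ M]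
variable (N : Type v) [AddCommGroup N] [Module R N] [Module B N]

/-- The relations `m b ⊗ n = m ⊗ b n` in `M ⊗[R] N`, where `M` is a right `B`-module and `N` is a
left `B`-module. (A right `B`-module is a module over `Bᵐᵒᵖ`, and `op b • m` is `m b`.) -/
def balancedRelations : Submodule R (M ⊗[R] N) :=
  Submodule.span R {z | ∃ (m : M) (b : B) (n : N), z = (op b • m) ⊗ₜ[R] n - m ⊗ₜ[R] (b • n)}

/-- The tensor product of a right `B`-module with a left `B`-module, as an `R`-module. -/
abbrev BalancedTensor : Type (max uM v) := (M ⊗[R] N) ⧸ balancedRelations R B M N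

variable {N} {N' : Type v} [AddCommGroup N'] [Module R N'] [Module B N']
  [IsScalarTower R B N] [IsScalarTower R B N']

/-- The map of tensor products over `B` induced by a map of left `B`-modules. -/
def balancedTensorMap (f : N →ₗ[B] N') : BalancedTensor R B M N →ₗ[R] BalancedTensor R B M N' :=
  Submodule.mapQ _ _ ((f.restrictScalars R).lTensor M) (by
    rw [balancedRelations, Submodule.span_le]
    rintro _ ⟨m, b, n, rfl⟩
    refine Submodule.subset_span ⟨m, b, f n, ?_⟩
    simp)

theorem balancedTensorMap_id : balancedTensorMap R B M (LinearMap.id : N →ₗ[B] N) =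
    LinearMap.id := by
  refine Submodule.linearMap_qext _ (TensorProduct.ext' fun m n => ?_)
  simp [balancedTensorMap]

theorem balancedTensorMap_comp {N'' : Type v} [AddCommGroup N''] [Module R N''] [Module B N'']
    [IsScalarTower R B N''] (g : N' →ₗ[B] N'') (f : N →ₗ[B] N') :
    balancedTensorMap R B M (g ∘ₗ f) = balancedTensorMap R B M g ∘ₗ balancedTensorMap R B M f := by
  refine Submodule.linearMap_qext _ (TensorProduct.ext' fun m n => ?_)
  simp [balancedTensorMap]

theorem balancedTensorMap_add (f g : N →ₗ[B] N') :
    balancedTensorMap R B M (f + g) = balancedTensorMap R B M f + balancedTensorMap R B M g := by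
  refine Submodule.linearMap_qext _ (TensorProduct.ext' fun m n => ?_)
  simp [balancedTensorMap]

end BalancedTensor

section Tor

variable (R : Type uR) [CommRing R] {B : Type uB} [Ring B] [Algebra R B]

/-- A module over an `R`-algebra is an `R`-module. -/
@[reducible]
def moduleOfAlgebra (N : ModuleCat.{v} B) : Module R N := Module.compHom N (algebraMap R B)

attribute [local instance] moduleOfAlgebra

theorem isScalarTower_moduleOfAlgebra (N : ModuleCat.{v} B) : IsScalarTower R B N where
  smul_assoc r b n := by
    change (r • b) • n = algebraMap R B r • b • n
    rw [Algebra.smul_def, mul_smul]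

attribute [local instance] isScalarTower_moduleOfAlgebra

/-- The functor `M ⊗_B -` from left `B`-modules to `R`-modules, for a right `B`-module `M`. -/
def balancedTensorFunctor (M : ModuleCat.{uM} Bᵐᵒᵖ) :
    ModuleCat.{v} B ⥤ ModuleCat.{max uM v} R where
  obj N := ModuleCat.of R (BalancedTensor R B M N)
  map f := ModuleCat.ofHom (balancedTensorMap R B M f.hom)
  map_id _ := congrArg ModuleCat.ofHom (balancedTensorMap_id R B M)
  map_comp f g := congrArg ModuleCat.ofHom (balancedTensorMap_comp R B M g.hom f.hom)

instance (M : ModuleCat.{uM} Bᵐᵒᵖ) :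
    (balancedTensorFunctor.{uR, uB, uM, v} R M).Additive where
  map_add {_ _ f g} := congrArg ModuleCat.ofHom (balancedTensorMap_add R B M f.hom g.hom)

/-- `Tor_n^B(M, N)` for a right `B`-module `M` and a left `B`-module `N` over an `R`-algebra `B`:
the `n`-th left derived functor of `M ⊗_B -`, as an `R`-module. -/
def algebraTor [Small.{v} B] (M : ModuleCat.{uM} Bᵐᵒᵖ) (N : ModuleCat.{v} B) (n : ℕ) :
    ModuleCat.{max uM v} R :=
  ((balancedTensorFunctor R M).leftDerived n).obj N

end Tor

/-! ### Modules over a quotient ring -/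

section QuotientModules

variable {A : Type uB} [Ring A] (I : Ideal A) [I.IsTwoSided]

/-- A left `A`-module on which the two-sided ideal `I` acts trivially, as a left module over
`A ⧸ I`. -/
def leftModuleQuotient (N : Type v) [AddCommGroup N] [Module A N]
    (h : ∀ a ∈ I, ∀ n : N, a • n = 0) : ModuleCat.{v} (A ⧸ I) :=
  letI : Module (A ⧸ I) N := Module.IsTorsionBySet.module (I := I) (fun n a => h a a.2 n)
  ModuleCat.of (A ⧸ I) N

/-- The `(A ⧸ I)ᵐᵒᵖ`-module structure on a right `A`-module on which the two-sided ideal `I` acts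
trivially: the class of `a` acts as `a` does. -/
@[reducible]
def rightQuotientModule {M : Type uM} [AddCommGroup M] [Module Aᵐᵒᵖ M]
    (h : ∀ a ∈ I, ∀ m : M, op a • m = 0) : Module (A ⧸ I)ᵐᵒᵖ M :=
  letI : SMul (A ⧸ I)ᵐᵒᵖ M :=
    ⟨fun b m => Quotient.liftOn' (unop b) (fun a => op a • m) (fun a a' haa' => by
      have hmem : a - a' ∈ I := (Submodule.quotientRel_def I).mp haa'
      have := h _ hmem m
      rwa [MulOpposite.op_sub, sub_smul, sub_eq_zero] at this)⟩
  Function.Surjective.moduleLeft (Ideal.Quotient.mk I).op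
    (fun b => by
      obtain ⟨a, ha⟩ := Ideal.Quotient.mk_surjective (unop b)
      exact ⟨op a, by simp [ha]⟩)
    (fun _ _ => rfl)

/-- A right `A`-module on which the two-sided ideal `I` acts trivially, as a right module over
`A ⧸ I`. -/
def rightModuleQuotient (M : Type uM) [AddCommGroup M] [Module Aᵐᵒᵖ M]
    (h : ∀ a ∈ I, ∀ m : M, op a • m = 0) : ModuleCat.{uM} (A ⧸ I)ᵐᵒᵖ :=
  letI : Module (A ⧸ I)ᵐᵒᵖ M := rightQuotientModule I h
  ModuleCat.of (A ⧸ I)ᵐᵒᵖ M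

end QuotientModules

/-! ### Naive-cellular algebras -/

section NaiveCellular

variable {Λ : Type uΛ} {G : Λ → Type uG} {S : Λ → Type uS}

/-- The `R`-span of the elements `C_{p,q}^σ` with `σ ∈ G(l)`, `p, q ∈ S(l)` and `l ∈ X`, where
`C l p σ q` is `C_{p,q}^σ`. -/
def cellSpan (R : Type uR) [CommRing R] {A : Type uA} [Ring A] [Algebra R A]
    (C : ∀ l, S l → G l → S l → A) (X : Set Λ) : Submodule R A :=
  Submodule.span R {x | ∃ l ∈ X, ∃ (p : S l) (σ : G l) (q : S l), x = C l p σ q}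

variable [PartialOrder Λ] [∀ l, Group (G l)] [∀ l, Fintype (S l)]

/-- A naive-cellular algebra structure on the `R`-algebra `A`, with poset `Λ`, groups `G(l)` and
finite sets of link states `S(l)`. The groups may be infinite. -/
structure NaiveCellular (R : Type uR) [CommRing R] (A : Type uA) [Ring A] [Algebra R A]
    (G : Λ → Type uG) [∀ l, Group (G l)] (S : Λ → Type uS) [∀ l, Fintype (S l)] where
  /-- `C l p σ q` is the basis element `C_{p,q}^σ`. -/
  C : ∀ l, S l → G l → S l → A
  injective_C : Function.Injective
    (fun i : Σ l, S l × G l × S l => C i.1 i.2.1 i.2.2.1 i.2.2.2)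
  linearIndependent_C : LinearIndependent R
    (fun i : Σ l, S l × G l × S l => C i.1 i.2.1 i.2.2.1 i.2.2.2)
  span_C : Submodule.span R
    (Set.range (fun i : Σ l, S l × G l × S l => C i.1 i.2.1 i.2.2.1 i.2.2.2)) = ⊤
  /-- The anti-involution `*`. -/
  invol : A →ₗ[R] A
  invol_mul : ∀ a b, invol (a * b) = invol b * invol a
  invol_invol : ∀ a, invol (invol a) = a
  invol_C : ∀ l p σ q, invol (C l p σ q) = C l q σ⁻¹ p
  /-- `a C_{p,q}^σ ≡ ∑_{p', σ'} r_a(p', σ' σ⁻¹, p) C_{p',q}^{σ'}` modulo `I_{< l}`, with coefficients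
  depending only on `a`, `p'`, `p` and `g = σ' σ⁻¹`. Here `r_a(p', g, p)` is `r p' p g`, it is
  nonzero for finitely many `g` only, and the sum over `σ' = g σ` is written as a sum over `g`. -/
  mul_C : ∀ l a, ∃ r : S l → S l → (G l →₀ R), ∀ p σ q,
    a * C l p σ q - ∑ p' : S l, (r p' p).sum (fun g c => c • C l p' (g * σ) q) ∈
      cellSpan R C (Set.Iio l)

namespace NaiveCellular

variable {R : Type uR} [CommRing R] {A : Type uA} [Ring A] [Algebra R A]
variable (D : NaiveCellular R A G S)

theorem mul_mem_cellSpan {X : Set Λ} (hX : IsLowerSet X) (a : A) {x : A}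
    (hx : x ∈ cellSpan R D.C X) : a * x ∈ cellSpan R D.C X := by
  induction hx using Submodule.span_induction with
  | mem x hx =>
    obtain ⟨l, hl, p, σ, q, rfl⟩ := hx
    obtain ⟨r, hr⟩ := D.mul_C l a
    have h₁ : cellSpan R D.C (Set.Iio l) ≤ cellSpan R D.C X := by
      refine Submodule.span_mono ?_
      rintro _ ⟨k, hk, h⟩
      exact ⟨k, hX (le_of_lt hk) hl, h⟩
    have h₂ := h₁ (hr p σ q)
    rw [sub_eq_add_neg] at h₂
    refine ((cellSpan R D.C X).add_mem_iff_left ?_).mp h₂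
    refine neg_mem (sum_mem fun p' _ => sum_mem fun g _ => Submodule.smul_mem _ _ ?_)
    exact Submodule.subset_span ⟨l, hl, p', g * σ, q, rfl⟩
  | zero => simp
  | add x y _ _ hx hy => rw [mul_add]; exact add_mem hx hy
  | smul c x _ hx => rw [mul_smul_comm]; exact Submodule.smul_mem _ _ hx

theorem invol_mem_cellSpan {X : Set Λ} {x : A}
    (hx : x ∈ cellSpan R D.C X) : D.invol x ∈ cellSpan R D.C X := by
  induction hx using Submodule.span_induction with
  | mem x hx =>
    obtain ⟨l, hl, p, σ, q, rfl⟩ := hx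
    exact Submodule.subset_span ⟨l, hl, q, σ⁻¹, p, D.invol_C l p σ q⟩
  | zero => simp
  | add x y _ _ hx hy => rw [map_add]; exact add_mem hx hy
  | smul c x _ hx => rw [map_smul]; exact Submodule.smul_mem _ _ hx

/-- The ideal `I_X` of `A` for a downward closed subset `X` of `Λ`: the `R`-span of the `C_{p,q}^σ`
with `σ ∈ G(l)`, `p, q ∈ S(l)` and `l ∈ X`. -/
def ideal (X : LowerSet Λ) : Ideal A where
  carrier := cellSpan R D.C (X : Set Λ)
  add_mem' := add_mem
  zero_mem' := zero_mem _
  smul_mem' a _ hx := D.mul_mem_cellSpan X.lower a hx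

theorem mem_ideal {X : LowerSet Λ} {x : A} : x ∈ D.ideal X ↔ x ∈ cellSpan R D.C (X : Set Λ) :=
  Iff.rfl

instance (X : LowerSet Λ) : (D.ideal X).IsTwoSided where
  mul_mem_of_left {x} b hx := by
    rw [mem_ideal] at hx ⊢
    have := D.invol_mem_cellSpan
      (D.mul_mem_cellSpan X.lower (D.invol b) (D.invol_mem_cellSpan hx))
    rwa [D.invol_mul, D.invol_invol, D.invol_invol] at this

theorem ideal_mono {X Y : LowerSet Λ} (h : Y ≤ X) : D.ideal Y ≤ D.ideal X := by
  intro x hx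
  rw [mem_ideal] at hx ⊢
  refine Submodule.span_mono ?_ hx
  rintro _ ⟨l, hl, h'⟩
  exact ⟨l, h hl, h'⟩

/-- The coefficient `r_a(p', g, p)`, for `p, p' ∈ S(l)` and `g ∈ G(l)`. It is uniquely determined:
see `r_eq`. -/
def r (l : Λ) (a : A) (p' : S l) (g : G l) (p : S l) : R :=
  (D.mul_C l a).choose p' p g

/-- The basis of `A` formed by the `C_{p,q}^σ`. -/
def basis : Module.Basis (Σ l, S l × G l × S l) R A :=
  Module.Basis.mk D.linearIndependent_C D.span_C.ge

theorem repr_C (l k : Λ) (p : S l) (σ : G l) (q : S l) (p' : S k) (σ' : G k) (q' : S k) :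
    D.basis.repr (D.C l p σ q) ⟨k, p', σ', q'⟩ =
      Finsupp.single (⟨l, p, σ, q⟩ : Σ l, S l × G l × S l) (1 : R) ⟨k, p', σ', q'⟩ := by
  have : D.C l p σ q = D.basis ⟨l, p, σ, q⟩ := by simp [basis]
  rw [this, Module.Basis.repr_self]

theorem repr_eq_zero {X : Set Λ} {x : A} (hx : x ∈ cellSpan R D.C X) {l : Λ} (hl : l ∉ X)
    (p : S l) (σ : G l) (q : S l) : D.basis.repr x ⟨l, p, σ, q⟩ = 0 := by
  classical
  induction hx using Submodule.span_induction with
  | mem x hx =>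
    obtain ⟨k, hk, p', σ', q', rfl⟩ := hx
    rw [repr_C, Finsupp.single_apply, if_neg]
    intro h
    obtain rfl : k = l := congrArg Sigma.fst h
    exact hl hk
  | zero => simp
  | add x y _ _ hx hy => simp [hx, hy]
  | smul c x _ hx => simp [hx]

theorem repr_invol (x : A) (l : Λ) (p : S l) (σ : G l) (q : S l) :
    D.basis.repr (D.invol x) ⟨l, p, σ, q⟩ = D.basis.repr x ⟨l, q, σ⁻¹, p⟩ := by
  classical
  have hx : x ∈ Submodule.span R
      (Set.range (fun i : Σ l, S l × G l × S l => D.C i.1 i.2.1 i.2.2.1 i.2.2.2)) := by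
    rw [D.span_C]; trivial
  induction hx using Submodule.span_induction with
  | zero => simp
  | add x y _ _ hx hy => simp [hx, hy]
  | smul c x _ hx => simp [hx]
  | mem x hx =>
    obtain ⟨⟨k, p', σ', q'⟩, rfl⟩ := hx
    rw [D.invol_C, repr_C, repr_C, Finsupp.single_apply, Finsupp.single_apply]
    congr 1
    by_cases h : k = l
    · subst h
      simp only [Sigma.mk.injEq, heq_eq_eq, true_and, Prod.mk.injEq, inv_eq_iff_eq_inv]
      exact propext ⟨fun h => ⟨h.2.2, h.2.1, h.1⟩, fun h => ⟨h.2.2, h.2.1, h.1⟩⟩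
    · simp [h]

/-- `r_a(p', g, p)` is the coefficient of `C_{p',q}^{g σ}` in `a C_{p,q}^σ`. -/
theorem r_eq (l : Λ) (a : A) (p' : S l) (g : G l) (p : S l) (σ : G l) (q : S l) :
    D.r l a p' g p = D.basis.repr (a * D.C l p σ q) ⟨l, p', g * σ, q⟩ := by
  classical
  have h := D.repr_eq_zero ((D.mul_C l a).choose_spec p σ q) (lt_irrefl l) p' (g * σ) q
  rw [map_sub, Finsupp.sub_apply, sub_eq_zero] at h
  rw [h, r, map_sum, Finsupp.finsetSum_apply, Finset.sum_eq_single p']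
  · rw [Finsupp.sum, map_sum, Finsupp.finsetSum_apply, Finset.sum_eq_single g]
    · simp [repr_C]
    · intro g' _ hg'
      simp [repr_C, hg']
    · intro hg
      simp [Finsupp.notMem_support_iff.mp hg]
  · intro p'' _ hp''
    rw [Finsupp.sum, map_sum, Finsupp.finsetSum_apply]
    refine Finset.sum_eq_zero fun g' _ => ?_
    simp [repr_C, hp'']
  · simp

/-- The function `s(σ₁, q₁, p₂, ρ) = r_{C_{p₁,q₁}^{σ₁}}(p₁, ρ, p₂)`, which does not depend on `p₁`
(see `s_eq`), so that `p₁ = q₁` may be taken. -/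
def s (l : Λ) (σ₁ : G l) (q₁ p₂ : S l) (ρ : G l) : R :=
  D.r l (D.C l q₁ σ₁ q₁) q₁ ρ p₂

theorem s_eq (l : Λ) (σ₁ : G l) (p₁ q₁ p₂ : S l) (ρ : G l) :
    D.s l σ₁ q₁ p₂ ρ = D.r l (D.C l p₁ σ₁ q₁) p₁ ρ p₂ := by
  have key (p : S l) : D.r l (D.C l p σ₁ q₁) p ρ p₂ =
      D.r l (D.C l p₂ 1 p₂) p₂ (ρ⁻¹ * σ₁) q₁ := by
    rw [D.r_eq l _ p ρ p₂ 1 p₂, D.r_eq l _ p₂ _ q₁ σ₁⁻¹ p]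
    have := D.repr_invol (D.C l p₂ 1 p₂ * D.C l q₁ σ₁⁻¹ p) l p ρ p₂
    rw [D.invol_mul, D.invol_C, D.invol_C, inv_inv, inv_one] at this
    rw [mul_one, this, mul_assoc, mul_inv_cancel, mul_one]
  rw [s, key, key]

/-- The link module `W(l)`: the free `R`-module on symbols `C_p` for `p ∈ S(l)`, where `C_p` is
`Finsupp.single p 1`. (The bilinear forms only involve its `R`-module structure, not the action of
`A` on it.) -/
abbrev LinkModule (_D : NaiveCellular R A G S) (l : Λ) : Type (max uS uR) := S l →₀ R

/-- The basis element `C_p` of `W(l)`. -/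
def linkC (l : Λ) (p : S l) : D.LinkModule l := Finsupp.single p 1

/-- The bilinear form `⟨ , ⟩_τ` on `W(l)`, given by `⟨C_q, C_p⟩_τ = s(1, q, p, τ)`. -/
def form (l : Λ) (τ : G l) : D.LinkModule l →ₗ[R] D.LinkModule l →ₗ[R] R :=
  Finsupp.linearCombination R fun q => Finsupp.linearCombination R fun p => D.s l 1 q p τ

end NaiveCellular

end NaiveCellular

end

/-! Cells can be removed one at a time. Take `l` minimal in `X \ Y`, put `Z = Y ∪ {l}`, `B = A/I_Y`
and `J = I_Z/I_Y`; it suffices to compare Tor over `B` and over `B/J`.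

Right multiplication preserves the left index of `C_{q,s}^τ` modulo `I_Y`, so as a right ideal `J`
is the direct sum of the finitely many rows of the cell `l`. The hypothesis on the forms says
exactly that `e_q = ∑ v_p C_{q,p}^σ` is a left identity on row `q` (`rowElement_mul_C`). Hence `j =
∑ e_q φ_q(j)` on `J`, with `φ_q` the row projections: `J` is a finitely generated projective right
ideal, and `J = J²` because `φ_q` takes values in `J` (`isRightDualBasis`).

Let `P → N` be a projective resolution over `B` with `J N = 0`. Then `J P ≅ J ⊗_B P` is acyclic: `J`
is projective and `J ⊗_B N = J² ⊗_B N = 0`. Concretely, the `φ_i` extend to maps `Φ_i` compatible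
with the differentials on `J P`, so a cycle `w = ∑ x_i Φ_i(w)` of `J P` is the boundary of an
element of `J P` (`exists_mem_smul_top_of_exact`). Thus `P/JP` is a projective resolution over `B/J`
(`reducedResolution`), and `M ⊗_B P = M ⊗_{B/J} P/JP` because `M J = 0`
(`balancedTensorFunctorReduceIso`). -/

noncomputable section

/-! ### Ideals that are finitely generated projective right ideals -/

section RightDualBasis

variable {B : Type*} [Ring B] {ι : Type*} [Fintype ι]

/-- A finite dual basis of the right ideal underlying `J`, with coordinates in `J`. The coordinate
functions are given as additive maps on all of `B`. -/
structure IsRightDualBasis (J : Ideal B) (x : ι → B) (φ : ι → B →+ B) : Prop where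
  mem : ∀ i, x i ∈ J
  coord_mem : ∀ i, ∀ j ∈ J, φ i j ∈ J
  coord_mul : ∀ i, ∀ j ∈ J, ∀ b, φ i (j * b) = φ i j * b
  sum_eq : ∀ j ∈ J, ∑ i, x i * φ i j = j

/-- The coordinate functions `φ` extend from `J` to `J P`. -/
def CoordsExtend (J : Ideal B) (φ : ι → B →+ B) (P : Type*) [AddCommGroup P] [Module B P] : Prop :=
  ∃ Φ : ι → P →+ P, ∀ i, ∀ j ∈ J, ∀ p, Φ i (j • p) = φ i j • p

variable {J : Ideal B} {x : ι → B} {φ : ι → B →+ B}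
variable {P P' P'' : Type*} [AddCommGroup P] [Module B P] [AddCommGroup P'] [Module B P']
  [AddCommGroup P''] [Module B P'']

/-- Zero maps work, since `φ i j` lies in `J` and also kills `P`. This is the only use of
`coord_mem`, that is, of `J = J²`. -/
theorem CoordsExtend.of_smul_eq_zero (h : IsRightDualBasis J x φ)
    (hP : ∀ j ∈ J, ∀ p : P, j • p = 0) : CoordsExtend J φ P :=
  ⟨fun _ => 0, fun i j hj p => by simp [hP _ (h.coord_mem i j hj)]⟩

/-- Embed `P` in a free module by a section `s`, apply `φ i` to each coordinate, and map back. The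
coordinates of `s (j • p)` are `j` times those of `s p`, so right linearity of `φ i` on `J`
suffices. -/
theorem CoordsExtend.of_projective (h : IsRightDualBasis J x φ) [Module.Projective B P] :
    CoordsExtend J φ P := by
  obtain ⟨s, hs⟩ := Module.projective_def'.mp ‹Module.Projective B P›
  refine ⟨fun i => (Finsupp.linearCombination B id).toAddMonoidHom.comp
    ((Finsupp.mapRange.addMonoidHom (φ i)).comp s.toAddMonoidHom), fun i j hj p => ?_⟩
  have key : Finsupp.mapRange (φ i) (map_zero _) (s (j • p)) = φ i j • s p := by
    ext k
    simp [h.coord_mul i j hj]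
  have hp : Finsupp.linearCombination B id (s p) = p := LinearMap.congr_fun hs p
  change Finsupp.linearCombination B id (Finsupp.mapRange (φ i) (map_zero _) (s (j • p))) = _
  rw [key, map_smul, hp]

/-- The coordinates `Φ i w` of a cycle `w` in `J P'` are again cycles, hence boundaries of some `y
i`; then `∑ x i • y i` is a preimage of `w`, in `J P` because the `x i` are in `J`. -/
theorem exists_mem_smul_top_of_exact (h : IsRightDualBasis J x φ) (d : P →ₗ[B] P')
    (d' : P' →ₗ[B] P'') (hd : ∀ w, d' w = 0 → ∃ y, d y = w)
    (h' : CoordsExtend J φ P') (h'' : CoordsExtend J φ P'')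
    {w : P'} (hw : w ∈ J • (⊤ : Submodule B P')) (hw' : d' w = 0) :
    ∃ y ∈ J • (⊤ : Submodule B P), d y = w := by
  obtain ⟨Φ, hΦ⟩ := h'
  obtain ⟨Ψ, hΨ⟩ := h''
  have h₁ (i : ι) : d' (Φ i w) = Ψ i (d' w) := by
    clear hw'
    refine Submodule.smul_induction_on hw (fun j hj p _ => ?_) (fun a b ha hb => ?_)
    · simp [hΦ i j hj, hΨ i j hj]
    · simp [ha, hb]
  have h₂ : ∑ i, x i • Φ i w = w := by
    clear hw' h₁
    refine Submodule.smul_induction_on hw (fun j hj p _ => ?_) (fun a b ha hb => ?_)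
    · simp only [hΦ _ j hj, smul_smul, ← Finset.sum_smul, h.sum_eq j hj]
    · simp [Finset.sum_add_distrib, ha, hb]
  choose y hy using fun i => hd (Φ i w) (by rw [h₁, hw', map_zero])
  refine ⟨∑ i, x i • y i, sum_mem fun i _ => Submodule.smul_mem_smul (h.mem i) trivial, ?_⟩
  simp [hy, h₂]

end RightDualBasis

/-! ### Extension of scalars along a surjective ring homomorphism -/

section SurjectiveExtension

variable {B B' : Type uB} [Ring B] [Ring B'] (f : B →+* B') (hf : Function.Surjective f)

/-- `P / J P`, where `J` is the kernel of `f`. -/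
abbrev KerQuotient (P : Type*) [AddCommGroup P] [Module B P] : Type _ :=
  P ⧸ (RingHom.ker f • (⊤ : Submodule B P))

/-- The action of the image of `f` on `P / J P`, where `J` is the kernel of `f`. -/
@[reducible]
def kerQuotientModule (P : Type*) [AddCommGroup P] [Module B P] : Module B' (KerQuotient f P) :=
  letI : Module (B ⧸ RingHom.ker f) (KerQuotient f P) :=
    Module.IsTorsionBySet.module (I := RingHom.ker f) (by
      rintro x ⟨a, ha⟩
      obtain ⟨p, rfl⟩ := Submodule.mkQ_surjective _ x
      rw [← map_smul]
      exact (Submodule.Quotient.mk_eq_zero _).mpr (Submodule.smul_mem_smul ha trivial))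
  Module.compHom _ (RingHom.quotientKerEquivOfSurjective hf).symm.toRingHom

theorem kerQuotientModule_smul (P : Type*) [AddCommGroup P] [Module B P] (b : B)
    (x : KerQuotient f P) :
    letI := kerQuotientModule f hf P
    f b • x = b • x := by
  let _ : Module (B ⧸ RingHom.ker f) (KerQuotient f P) :=
    Module.IsTorsionBySet.module (I := RingHom.ker f) (by
      rintro x ⟨a, ha⟩
      obtain ⟨p, rfl⟩ := Submodule.mkQ_surjective _ x
      rw [← map_smul]
      exact (Submodule.Quotient.mk_eq_zero _).mpr (Submodule.smul_mem_smul ha trivial))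
  change (RingHom.quotientKerEquivOfSurjective hf).symm (f b) • x = _
  rw [RingHom.quotientKerEquivOfSurjective_symm_apply]
  rfl

/-- `P / J P` as a `B'`-module, where `J` is the kernel of the surjection `f : B → B'`. -/
def kerQuotient (P : ModuleCat.{v} B) : ModuleCat.{v} B' :=
  letI := kerQuotientModule f hf P
  ModuleCat.of B' (KerQuotient f P)

/-- The projection `P → P / J P`. -/
def toKerQuotient (P : ModuleCat.{v} B) : P →+ kerQuotient f hf P :=
  (Submodule.mkQ (RingHom.ker f • (⊤ : Submodule B P))).toAddMonoidHom

theorem toKerQuotient_surjective (P : ModuleCat.{v} B) :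
    Function.Surjective (toKerQuotient f hf P) :=
  Submodule.mkQ_surjective _

theorem toKerQuotient_smul (P : ModuleCat.{v} B) (b : B) (p : P) :
    toKerQuotient f hf P (b • p) = f b • toKerQuotient f hf P p :=
  (kerQuotientModule_smul f hf P b (Submodule.Quotient.mk p)).symm

theorem toKerQuotient_eq_zero (P : ModuleCat.{v} B) (p : P) :
    toKerQuotient f hf P p = 0 ↔ p ∈ RingHom.ker f • (⊤ : Submodule B P) :=
  Submodule.Quotient.mk_eq_zero _

/-- An additive map from a `B`-module to a `B'`-module that is linear along `f` factors through
`P / J P`. -/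
def kerQuotientLift (P : ModuleCat.{v} B) {E : Type*} [AddCommGroup E] [Module B' E]
    (g : P →+ E) (hg : ∀ b p, g (b • p) = f b • g p) : kerQuotient f hf P →ₗ[B'] E :=
  letI : Module B E := Module.compHom E f
  letI g' : KerQuotient f P →ₗ[B] E :=
    Submodule.liftQ _ { g with map_smul' := hg } (by
      rw [Submodule.smul_le]
      intro b hb p _
      exact (hg b p).trans (by rw [RingHom.mem_ker.mp hb, zero_smul]))
  { toFun := g'
    map_add' := map_add g'
    map_smul' := fun b x => by
      obtain ⟨b, rfl⟩ := hf b
      obtain ⟨p, rfl⟩ := toKerQuotient_surjective f hf P x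
      rw [← toKerQuotient_smul]
      exact hg b p }

/-- An additive map on `P` that vanishes on `J P` factors through `P / J P`. -/
def kerQuotientAddLift (P : ModuleCat.{v} B) {E : Type*} [AddCommGroup E] (g : P →+ E)
    (hg : ∀ b ∈ RingHom.ker f, ∀ p, g (b • p) = 0) : kerQuotient f hf P →+ E :=
  QuotientAddGroup.lift (RingHom.ker f • (⊤ : Submodule B P)).toAddSubgroup g fun _ hp =>
    Submodule.smul_induction_on hp (fun b hb p _ => hg b hb p) fun _ _ ha hb => add_mem ha hb

/-- The map `P / J P → Q / J Q` induced by a map `P → Q`. -/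
def kerQuotientMap {P Q : ModuleCat.{v} B} (g : P ⟶ Q) : kerQuotient f hf P ⟶ kerQuotient f hf Q :=
  ModuleCat.ofHom (X := kerQuotient f hf P) (Y := kerQuotient f hf Q)
    (kerQuotientLift f hf P ((toKerQuotient f hf Q).comp g.hom.toAddMonoidHom)
    fun b p => (congrArg (toKerQuotient f hf Q) (map_smul g.hom b p)).trans
      (toKerQuotient_smul f hf Q b _))

theorem kerQuotientMap_apply {P Q : ModuleCat.{v} B} (g : P ⟶ Q) (p : P) :
    kerQuotientMap f hf g (toKerQuotient f hf P p) = toKerQuotient f hf Q (g p) :=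
  rfl

theorem kerQuotient_hom_ext {P : ModuleCat.{v} B} {E : ModuleCat.{v} B'}
    {g h : kerQuotient f hf P ⟶ E}
    (H : ∀ p, g (toKerQuotient f hf P p) = h (toKerQuotient f hf P p)) : g = h := by
  ext x
  obtain ⟨p, rfl⟩ := toKerQuotient_surjective f hf P x
  exact H p

/-- The functor `P ↦ P / J P` from `B`-modules to `B'`-modules, where `J` is the kernel of the
surjection `f : B → B'`. -/
def kerQuotientFunctor : ModuleCat.{v} B ⥤ ModuleCat.{v} B' where
  obj P := kerQuotient f hf P
  map g := kerQuotientMap f hf g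
  map_id _ := kerQuotient_hom_ext f hf fun _ => rfl
  map_comp _ _ := kerQuotient_hom_ext f hf fun _ => rfl

instance : (kerQuotientFunctor.{uB, v} f hf).Additive where
  map_add {_ Q g h} := kerQuotient_hom_ext f hf fun p => map_add (toKerQuotient f hf Q) (g p) (h p)

/-- `P ↦ P / J P` is left adjoint to restriction of scalars, which preserves surjections, so a
lifting problem for `P / J P` transposes to one for `P`. -/
instance projective_kerQuotient (P : ModuleCat.{v} B) [Projective P] :
    Projective (kerQuotient f hf P) where
  factors {E X} g e he := by
    let e' := (ModuleCat.restrictScalars f).map e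
    have : Epi e' := (ModuleCat.epi_iff_surjective _).mpr ((ModuleCat.epi_iff_surjective e).mp he)
    let g' : P ⟶ (ModuleCat.restrictScalars f).obj X := ModuleCat.ofHom
      (Y := (ModuleCat.restrictScalars f).obj X)
      { toFun := fun p => g (toKerQuotient f hf P p)
        map_add' := fun a b => by
          rw [map_add, map_add]
          rfl
        map_smul' := fun b p => by
          rw [toKerQuotient_smul, map_smul]
          rfl }
    let k := Projective.factorThru g' e'
    have hk : k ≫ e' = g' := Projective.factorThru_comp g' e'
    refine ⟨ModuleCat.ofHom (X := kerQuotient f hf P)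
        (kerQuotientLift f hf P (E := E) k.hom.toAddMonoidHom fun b p => ?_),
      kerQuotient_hom_ext f hf fun p => ?_⟩
    · exact map_smul k.hom b p
    · exact ConcreteCategory.congr_hom hk p

end SurjectiveExtension

/-! ### Reduction of projective resolutions -/

section ReductionOfResolutions

variable {B B' : Type uB} [Ring B] [Ring B'] (f : B →+* B')
  (hf : Function.Surjective f)
variable {N : ModuleCat.{v} B} {N' : ModuleCat.{v} B'} (g : N ≃+ N')
  (hg : ∀ b n, g (b • n) = f b • g n)

variable (N') in
/-- The augmentation of the reduced resolution. -/
def kerQuotientAugmentation {P : ModuleCat.{v} B} (π : P ⟶ N) : kerQuotient f hf P ⟶ N' :=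
  ModuleCat.ofHom (X := kerQuotient f hf P)
    (kerQuotientLift f hf P (g.toAddMonoidHom.comp π.hom.toAddMonoidHom) fun b p =>
      (congrArg g (map_smul π.hom b p)).trans (hg b _))

variable {ι : Type*} [Fintype ι] {x : ι → B} {φ : ι → B →+ B}

/-- A cycle modulo `J` is corrected to a true cycle: `d' w` is a cycle in `J P''`, hence equals `d'
y` with `y` in `J P'`, and `w - y` is a boundary. This consumes exactness at both `P'` and `P''`. -/
theorem exact_kerQuotientMap (h : IsRightDualBasis (RingHom.ker f) x φ) {P P' P'' : ModuleCat.{v} B}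
    {d : P ⟶ P'} {d' : P' ⟶ P''} (hd : ∀ w, d' w = 0 → ∃ y, d y = w)
    {Z : ModuleCat.{v} B} {e : P'' ⟶ Z}
    (hd' : ∀ w, e w = 0 → ∃ y, d' y = w) (he : ∀ y, e (d' y) = 0)
    (h' : CoordsExtend (RingHom.ker f) φ P'')
    (h'' : CoordsExtend (RingHom.ker f) φ Z) (w : kerQuotient f hf P')
    (hw : kerQuotientMap f hf d' w = 0) : ∃ y, kerQuotientMap f hf d y = w := by
  obtain ⟨w, rfl⟩ := toKerQuotient_surjective f hf P' w
  rw [kerQuotientMap_apply, toKerQuotient_eq_zero] at hw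
  obtain ⟨y, hy, hyw⟩ := exists_mem_smul_top_of_exact h d'.hom e.hom hd' h' h'' hw (he w)
  obtain ⟨z, hz⟩ := hd (w - y) (by
    rw [map_sub, sub_eq_zero]
    exact hyw.symm)
  refine ⟨toKerQuotient f hf P z, ?_⟩
  rw [kerQuotientMap_apply, hz, map_sub, (toKerQuotient_eq_zero f hf P' y).mpr hy, sub_zero]

/-- If the kernel `J` of the surjection `f : B → B'` is projective as a right ideal and has
coordinates in `J`, then `P / J P` is a projective resolution over `B'` of a `B'`-module, for any
projective resolution `P` over `B`. -/
def reducedResolution [Small.{v} B] (h : IsRightDualBasis (RingHom.ker f) x φ)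
    (P : ProjectiveResolution N) :
    ProjectiveResolution N' where
  complex := ((kerQuotientFunctor f hf).mapHomologicalComplex _).obj P.complex
  projective n := projective_kerQuotient f hf (P.complex.X n)
  π := (ChainComplex.toSingle₀Equiv _ _).symm
    ⟨kerQuotientAugmentation f hf N' g hg (P.π.f 0), kerQuotient_hom_ext f hf fun p =>
      (congrArg g (ConcreteCategory.congr_hom P.complex_d_comp_π_f_zero p)).trans (map_zero g)⟩
  quasiIso := by
    have hP (n : ℕ) : CoordsExtend (RingHom.ker f) φ (P.complex.X n) := .of_projective h
    have hN : CoordsExtend (RingHom.ker f) φ N := .of_smul_eq_zero h fun j hj n => by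
      apply g.injective
      rw [hg, RingHom.mem_ker.mp hj, zero_smul, map_zero]
    have hd (n : ℕ) := (ShortComplex.moduleCat_exact_iff _).mp (P.exact_succ n)
    have hd₀ := (ShortComplex.moduleCat_exact_iff _).mp P.exact₀
    have hπ : Function.Surjective (P.π.f 0) := (ModuleCat.epi_iff_surjective _).mp inferInstance
    refine ⟨fun n => ?_⟩
    obtain _ | n := n
    -- In degree 0 the claim is exactness of `P₁/JP₁ → P₀/JP₀ → N' → 0`; this is right exactness and
    -- needs no dual basis.
    · rw [ChainComplex.quasiIsoAt₀_iff]
      refine (ShortComplex.quasiIso_iff_of_zeros' _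
        ((((kerQuotientFunctor f hf).mapHomologicalComplex _).obj P.complex).shape 0 0
          (Nat.succ_ne_zero 0)) rfl rfl).mpr ?_
      refine ⟨(ShortComplex.moduleCat_exact_iff _).mpr fun w hw => ?_,
        (ModuleCat.epi_iff_surjective _).mpr fun z => ?_⟩
      · obtain ⟨p, rfl⟩ := toKerQuotient_surjective f hf (P.complex.X 0) w
        obtain ⟨y, hy⟩ := hd₀ p (g.injective (Eq.trans hw (map_zero g).symm))
        exact ⟨toKerQuotient f hf (P.complex.X 1) y,
          congrArg (toKerQuotient f hf (P.complex.X 0)) hy⟩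
      · obtain ⟨p, hp⟩ := hπ (g.symm z)
        exact ⟨toKerQuotient f hf (P.complex.X 0) p, (congrArg g hp).trans (g.apply_symm_apply z)⟩
    · rw [quasiIsoAt_iff_exactAt' _ _ (ChainComplex.exactAt_succ_single_obj _ _),
        HomologicalComplex.exactAt_iff' _ (n + 2) (n + 1) n (by simp) (by simp),
        ShortComplex.moduleCat_exact_iff]
      -- Degree 1 is separate: two steps further on stands the resolved module `N`, not a term of
      -- the complex.
      obtain _ | n := n
      · exact exact_kerQuotientMap f hf h (hd 0) hd₀
          (fun y => ConcreteCategory.congr_hom P.complex_d_comp_π_f_zero y) (hP 0) hN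
      · exact exact_kerQuotientMap f hf h (hd (n + 1)) (hd n)
          (fun y => ConcreteCategory.congr_hom (P.complex.d_comp_d (n + 2) (n + 1) n) y)
          (hP _) (hP _)

end ReductionOfResolutions

/-! ### Comparison of tensor products and of Tor -/

section CompareTor

attribute [local instance] moduleOfAlgebra isScalarTower_moduleOfAlgebra

variable {R : Type uR} [CommRing R] {B B' : Type uB} [Ring B] [Ring B'] [Algebra R B]
  [Algebra R B'] (f : B →ₐ[R] B') (hf : Function.Surjective (f : B →+* B'))
  {M : ModuleCat.{uM} Bᵐᵒᵖ} {M' : ModuleCat.{uM} B'ᵐᵒᵖ} (e : M ≃+ M')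
  (he : ∀ b m, e (op b • m) = op (f b) • e m)

theorem moduleOfAlgebra_smul (P : ModuleCat.{v} B) (r : R) (p : P) :
    r • p = algebraMap R B r • p :=
  rfl

theorem moduleOfAlgebra_op_smul (r : R) (m : M) : r • m = op (algebraMap R B r) • m :=
  rfl

/-- An additive equivalence of right modules along `f` is `R`-linear. -/
def rightLinearEquiv : M ≃ₗ[R] M' :=
  { e with
    map_smul' := fun r m => by
      change e (r • m) = r • e m
      rw [moduleOfAlgebra_op_smul, moduleOfAlgebra_op_smul, he, AlgHom.commutes] }

/-- The projection `P → P / J P` as an `R`-linear map. -/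
def toKerQuotientLinear (P : ModuleCat.{v} B) : P →ₗ[R] kerQuotient (f : B →+* B') hf P :=
  { toKerQuotient (f : B →+* B') hf P with
    map_smul' := fun r p => by
      change toKerQuotient (f : B →+* B') hf P (r • p) = r • toKerQuotient (f : B →+* B') hf P p
      rw [moduleOfAlgebra_smul, moduleOfAlgebra_smul, toKerQuotient_smul]
      congr 1
      exact f.commutes r }

theorem balancedTensor_mk_smul (P : ModuleCat.{v} B) (m : M) (b : B) (p : P) :
    (Submodule.Quotient.mk ((op b • m) ⊗ₜ[R] p) : BalancedTensor R B M P) =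
      Submodule.Quotient.mk (m ⊗ₜ[R] (b • p)) :=
  (Submodule.Quotient.eq _).mpr (Submodule.subset_span ⟨m, b, p, rfl⟩)

/-- The map `M ⊗_B P → M' ⊗_{B'} (P / J P)`. -/
def balancedTensorReduce (P : ModuleCat.{v} B) :
    BalancedTensor R B M P →ₗ[R] BalancedTensor R B' M' (kerQuotient (f : B →+* B') hf P) :=
  Submodule.mapQ _ _
    (TensorProduct.map (rightLinearEquiv f e he).toLinearMap (toKerQuotientLinear f hf P)) (by
      rw [balancedRelations, Submodule.span_le]
      rintro _ ⟨m, b, p, rfl⟩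
      refine Submodule.subset_span ⟨e m, f b, toKerQuotient (f : B →+* B') hf P p, ?_⟩
      rw [map_sub, TensorProduct.map_tmul, TensorProduct.map_tmul]
      exact congrArg₂ (fun a b => a - b) (congrArg (· ⊗ₜ[R] _) (he b m))
        (congrArg (_ ⊗ₜ[R] ·) (toKerQuotient_smul (f : B →+* B') hf P b p)))

/-- For `m ∈ M`, the map `P / J P → M ⊗_B P` given by `p ↦ m ⊗ p`. -/
def balancedTensorUnreduceAux (P : ModuleCat.{v} B) (m : M') :
    kerQuotient (f : B →+* B') hf P →+ BalancedTensor R B M P :=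
  kerQuotientAddLift (f : B →+* B') hf P
    ((Submodule.mkQ (balancedRelations R B M P) ∘ₗ
      TensorProduct.mk R M P (e.symm m)).toAddMonoidHom) fun b hb p => by
    change (Submodule.Quotient.mk (e.symm m ⊗ₜ[R] (b • p)) : BalancedTensor R B M P) = 0
    -- The kernel of `f` kills `M`, so `p ↦ m ⊗ p` vanishes on `J P`.
    have : op b • e.symm m = 0 := e.injective (by
      rw [he, show f b = 0 from hb, op_zero, zero_smul, map_zero])
    rw [← balancedTensor_mk_smul, this, TensorProduct.zero_tmul, Submodule.Quotient.mk_zero]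

theorem balancedTensorUnreduceAux_apply (P : ModuleCat.{v} B) (m : M) (p : P) :
    balancedTensorUnreduceAux f hf e he P (e m) (toKerQuotient (f : B →+* B') hf P p) =
      (Submodule.Quotient.mk (m ⊗ₜ[R] p) : BalancedTensor R B M P) :=
  congrArg (fun m => (Submodule.Quotient.mk (m ⊗ₜ[R] p) : BalancedTensor R B M P))
    (e.symm_apply_apply m)

/-- The map `M' ⊗_{B'} (P / J P) → M ⊗_B P`. -/
def balancedTensorUnreduce (P : ModuleCat.{v} B) :
    BalancedTensor R B' M' (kerQuotient (f : B →+* B') hf P) →ₗ[R] BalancedTensor R B M P :=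
  Submodule.liftQ _ (TensorProduct.lift (LinearMap.mk₂ R
    (fun m x => balancedTensorUnreduceAux f hf e he P m x)
    (fun m m' x => by
      obtain ⟨m, rfl⟩ := e.surjective m
      obtain ⟨m', rfl⟩ := e.surjective m'
      obtain ⟨p, rfl⟩ := toKerQuotient_surjective (f : B →+* B') hf P x
      simp only [← map_add e, balancedTensorUnreduceAux_apply, TensorProduct.add_tmul,
        Submodule.Quotient.mk_add])
    (fun r m x => by
      obtain ⟨m, rfl⟩ := (rightLinearEquiv f e he).surjective m
      obtain ⟨p, rfl⟩ := toKerQuotient_surjective (f : B →+* B') hf P x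
      rw [← map_smul]
      exact (balancedTensorUnreduceAux_apply f hf e he P (r • m) p).trans
        (congrArg (r • ·) (balancedTensorUnreduceAux_apply f hf e he P m p).symm))
    (fun m x y => map_add _ x y)
    (fun r m x => by
      obtain ⟨m, rfl⟩ := e.surjective m
      obtain ⟨p, rfl⟩ := toKerQuotient_surjective (f : B →+* B') hf P x
      have h₁ := (toKerQuotientLinear f hf P).map_smul r p
      have h₂ := balancedTensorUnreduceAux_apply f hf e he P m (r • p)
      rw [TensorProduct.tmul_smul] at h₂
      exact (congrArg _ h₁.symm).trans
        (h₂.trans (congrArg (r • ·) (balancedTensorUnreduceAux_apply f hf e he P m p).symm))))) (by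
      rw [balancedRelations, Submodule.span_le]
      rintro _ ⟨m, b, x, rfl⟩
      obtain ⟨m, rfl⟩ := e.surjective m
      obtain ⟨b, rfl⟩ := hf b
      obtain ⟨p, rfl⟩ := toKerQuotient_surjective (f : B →+* B') hf P x
      rw [SetLike.mem_coe, LinearMap.mem_ker, map_sub, sub_eq_zero, TensorProduct.lift.tmul,
        TensorProduct.lift.tmul, LinearMap.mk₂_apply, LinearMap.mk₂_apply, ← toKerQuotient_smul,
        balancedTensorUnreduceAux_apply, ← balancedTensor_mk_smul,
        ← balancedTensorUnreduceAux_apply f hf e he, he]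
      rfl)

/-- `M ⊗_B P` is isomorphic to `M' ⊗_{B'} (P / J P)`, naturally in `P`. -/
def balancedTensorFunctorReduceIso :
    balancedTensorFunctor.{uR, uB, uM, v} R M ≅
      kerQuotientFunctor (f : B →+* B') hf ⋙ balancedTensorFunctor R M' :=
  NatIso.ofComponents (fun P => LinearEquiv.toModuleIso
    (LinearEquiv.ofLinearMap (balancedTensorReduce f hf e he P) (balancedTensorUnreduce f hf e he P)
      (by
        refine Submodule.linearMap_qext _ (TensorProduct.ext' fun m x => ?_)
        obtain ⟨m, rfl⟩ := e.surjective m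
        obtain ⟨p, rfl⟩ := toKerQuotient_surjective (f : B →+* B') hf P x
        exact congrArg (balancedTensorReduce f hf e he P)
          (balancedTensorUnreduceAux_apply f hf e he P m p))
      (by
        refine Submodule.linearMap_qext _ (TensorProduct.ext' fun m p => ?_)
        exact balancedTensorUnreduceAux_apply f hf e he P m p)))
    fun {P Q} g => by
      refine ModuleCat.hom_ext (Submodule.linearMap_qext _ (TensorProduct.ext' fun m p => ?_))
      rfl

variable {ι : Type*} [Fintype ι] {x : ι → B} {φ : ι → B →+ B}

include hf he in
/-- If the kernel `J` of a surjection `f : B → B'` has a finite right dual basis with coordinates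
in `J`, then `Tor` over `B` and over `B'` agree on `B'`-modules. -/
theorem algebraTor_iso_of_isRightDualBasis [Small.{v} B] [Small.{v} B']
    (h : IsRightDualBasis (RingHom.ker (f : B →+* B')) x φ) {N : ModuleCat.{v} B}
    {N' : ModuleCat.{v} B'} (g : N ≃+ N') (hg : ∀ b n, g (b • n) = f b • g n) (n : ℕ) :
    Nonempty (algebraTor R M N n ≃ₗ[R] algebraTor R M' N' n) := by
  let P := ProjectiveResolution.of N
  -- Both Tor modules are computed from the single resolution `P`, so isomorphic complexes result
  -- and no comparison of resolutions is needed.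
  let P' := reducedResolution (f : B →+* B') hf g hg h P
  let α : algebraTor R M N n ≅ algebraTor R M' N' n :=
    P.isoLeftDerivedObj (balancedTensorFunctor R M) n ≪≫
      (HomologicalComplex.homologyFunctor _ _ n).mapIso
        ((NatIso.mapHomologicalComplex (balancedTensorFunctorReduceIso f hf e he) _).app
          P.complex) ≪≫
      (P'.isoLeftDerivedObj (balancedTensorFunctor R M') n).symm
  exact ⟨α.toLinearEquiv⟩

end CompareTor

/-! ### Cell ideals -/

section CellIdeals

variable {Λ : Type uΛ} {G : Λ → Type uG} {S : Λ → Type uS}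
variable [PartialOrder Λ] [∀ l, Group (G l)] [∀ l, Fintype (S l)]

namespace NaiveCellular

variable {R : Type uR} [CommRing R] {A : Type uA} [Ring A] [Algebra R A]
variable (D : NaiveCellular R A G S)

/-! ### Coefficients of products inside one cell. -/

theorem basis_apply (i : Σ l, S l × G l × S l) : D.basis i = D.C i.1 i.2.1 i.2.2.1 i.2.2.2 := by
  simp [basis]

theorem mem_cellSpan_iff {X : Set Λ} {a : A} : a ∈ cellSpan R D.C X ↔
    ∀ l ∉ X, ∀ p σ q, D.basis.repr a ⟨l, p, σ, q⟩ = 0 := by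
  refine ⟨fun h l hl => D.repr_eq_zero h hl, fun h => ?_⟩
  rw [← D.basis.linearCombination_repr a, Finsupp.linearCombination_apply]
  refine sum_mem fun ⟨l, p, σ, q⟩ hi => Submodule.smul_mem _ _ ?_
  rw [basis_apply]
  refine Submodule.subset_span ⟨l, ?_, p, σ, q, rfl⟩
  by_contra hl
  exact Finsupp.mem_support_iff.mp hi (h l hl p σ q)

theorem repr_mul_C_of_ne (l : Λ) (a : A) (p : S l) (σ : G l) {q : S l} (p' : S l) (σ' : G l)
    {q' : S l} (hq : q' ≠ q) : D.basis.repr (a * D.C l p σ q) ⟨l, p', σ', q'⟩ = 0 := by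
  classical
  obtain ⟨r, hr⟩ := D.mul_C l a
  have h := D.repr_eq_zero (hr p σ q) (lt_irrefl l) p' σ' q'
  rw [map_sub, Finsupp.sub_apply, sub_eq_zero] at h
  rw [h, map_sum, Finsupp.finsetSum_apply]
  refine Finset.sum_eq_zero fun p'' _ => ?_
  rw [Finsupp.sum, map_sum, Finsupp.finsetSum_apply]
  refine Finset.sum_eq_zero fun g _ => ?_
  simp [repr_C, hq.symm]

/-- The anti-involution turns the fact that left multiplication fixes the right index into its
mirror image, which makes rows stable under right multiplication modulo lower cells. -/
theorem repr_C_mul_of_ne (l : Λ) (a : A) {p : S l} (σ : G l) (q : S l) {p' : S l} (σ' : G l)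
    (q' : S l) (hp : p' ≠ p) : D.basis.repr (D.C l p σ q * a) ⟨l, p', σ', q'⟩ = 0 := by
  rw [← D.invol_invol (D.C l p σ q * a), repr_invol, D.invol_mul, D.invol_C]
  exact D.repr_mul_C_of_ne l _ q σ⁻¹ q' σ'⁻¹ hp

/-- Applying `*` to `C_{p,q}^σ C_{p,p}^1` gives `C_{p,p}^1 C_{q,p}^{σ⁻¹}` and inverts the group
label `g`. Relative to `σ⁻¹` the new label is `g⁻¹ σ`. -/
theorem s_eq_s_one (l : Λ) (σ g : G l) (p q : S l) : D.s l σ q p g = D.s l 1 p q (g⁻¹ * σ) := by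
  rw [D.s_eq l σ p, D.s_eq l 1 p, D.r_eq l _ p g p 1 p, D.r_eq l _ p _ q σ⁻¹ p,
    ← D.invol_invol (D.C l p σ q * _), repr_invol, D.invol_mul, D.invol_C, D.invol_C, inv_one,
    mul_one, mul_assoc, mul_inv_cancel, mul_one]

/-- Products within a cell are thus governed by the forms: the coefficient is `⟨C_{p₂}, C_{q₁}⟩` at
`σ₂ ρ⁻¹ σ₁`. -/
theorem repr_C_mul_C (l : Λ) (p₁ q₁ p₂ q₂ : S l) (σ₁ σ₂ ρ : G l) :
    D.basis.repr (D.C l p₁ σ₁ q₁ * D.C l p₂ σ₂ q₂) ⟨l, p₁, ρ, q₂⟩ =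
      D.s l 1 p₂ q₁ (σ₂ * ρ⁻¹ * σ₁) := by
  have h := D.r_eq l (D.C l p₁ σ₁ q₁) p₁ (ρ * σ₂⁻¹) p₂ σ₂ q₂
  rw [inv_mul_cancel_right, ← D.s_eq, s_eq_s_one, mul_inv_rev, inv_inv] at h
  exact h.symm

theorem form_linkC (l : Λ) (τ : G l) (q : S l) (v : D.LinkModule l) :
    D.form l τ (D.linkC l q) v = ∑ p, v p * D.s l 1 q p τ := by
  rw [form, linkC, Finsupp.linearCombination_single, one_smul, Finsupp.linearCombination_apply,
    Finsupp.sum_fintype _ _ (by simp)]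
  rfl

/-- The element `∑ v_p C_{q,p}^σ` attached to an element `v` of the link module. -/
def rowElement (l : Λ) (q : S l) (σ : G l) (v : D.LinkModule l) : A :=
  ∑ p, v p • D.C l q σ p

/-- If `⟨C_q, v⟩_τ` is `1` for `τ = σ` and `0` otherwise, then `∑ v_p C_{q,p}^σ` is a left identity
for the `q`-th row of the cell `l`, modulo lower cells. -/
theorem rowElement_mul_C {l : Λ} {q : S l} {σ : G l} {v : D.LinkModule l}
    (h₁ : D.form l σ (D.linkC l q) v = 1)
    (h₀ : ∀ τ : G l, τ ≠ σ → D.form l τ (D.linkC l q) v = 0) (τ : G l) (s : S l) :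
    D.rowElement l q σ v * D.C l q τ s - D.C l q τ s ∈ cellSpan R D.C (Set.Iio l) := by
  classical
  rw [mem_cellSpan_iff]
  intro k hk p' ρ s'
  by_cases hkl : k = l
  · subst hkl
    rw [map_sub, Finsupp.sub_apply, sub_eq_zero, repr_C]
    by_cases hs : s' = s
    · subst hs
      rw [rowElement, Finset.sum_mul, map_sum, Finsupp.finsetSum_apply]
      simp only [smul_mul_assoc, map_smul, Finsupp.smul_apply, smul_eq_mul]
      by_cases hp : p' = q
      · subst hp
        simp only [repr_C_mul_C, ← form_linkC]
        -- The coefficient is `⟨C_q, v⟩` at `τ ρ⁻¹ σ`, an index equal to `σ` only when `ρ = τ`.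
        by_cases hρ : τ = ρ
        · subst hρ
          simp [h₁]
        · rw [h₀, Finsupp.single_eq_of_ne]
          · simpa using Ne.symm hρ
          · rwa [ne_eq, mul_eq_right, mul_inv_eq_one]
      · simp [D.repr_C_mul_of_ne _ _ _ _ _ _ hp, Ne.symm hp]
    · rw [D.repr_mul_C_of_ne _ _ _ _ _ _ hs, Finsupp.single_eq_of_ne]
      simp [hs]
  -- Both terms lie in the span of the cells `≤ l`, so other cells not below `l` do not occur.
  · refine D.repr_eq_zero (X := Set.Iic l) ?_ (fun h => hk (lt_of_le_of_ne h hkl)) _ _ _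
    have hC : D.C l q τ s ∈ cellSpan R D.C (Set.Iic l) :=
      Submodule.subset_span ⟨l, le_rfl, q, τ, s, rfl⟩
    exact sub_mem (D.mul_mem_cellSpan (isLowerSet_Iic l) _ hC) hC

theorem rowElement_mem {X : Set Λ} {l : Λ} (hl : l ∈ X) (q : S l) (σ : G l)
    (v : D.LinkModule l) : D.rowElement l q σ v ∈ cellSpan R D.C X :=
  sum_mem fun p _ => Submodule.smul_mem _ _ (Submodule.subset_span ⟨l, hl, q, σ, p, rfl⟩)

/-- The projection of `A` onto the span of the `q`-th row of the cell `l`. -/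
def rowProj (l : Λ) (q : S l) : A →ₗ[R] A :=
  open Classical in
  D.basis.constr R fun i => if ∃ τ s, i = ⟨l, q, τ, s⟩ then D.basis i else 0

theorem repr_rowProj (l : Λ) (q : S l) (x : A) (τ : G l) (s : S l) :
    D.basis.repr (D.rowProj l q x) ⟨l, q, τ, s⟩ = D.basis.repr x ⟨l, q, τ, s⟩ := by
  classical
  suffices h : Finsupp.lapply ⟨l, q, τ, s⟩ ∘ₗ D.basis.repr.toLinearMap ∘ₗ D.rowProj l q =
      Finsupp.lapply ⟨l, q, τ, s⟩ ∘ₗ D.basis.repr.toLinearMap from LinearMap.congr_fun h x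
  refine D.basis.ext fun i => ?_
  simp only [rowProj, LinearMap.comp_apply, Module.Basis.constr_basis]
  split_ifs with h
  · rfl
  · simp only [map_zero]
    symm
    simpa using Finsupp.single_eq_of_ne fun h' => h ⟨τ, s, h'.symm⟩

theorem repr_rowProj_eq_zero (l : Λ) (q : S l) (x : A) {i : Σ l, S l × G l × S l}
    (hi : ∀ τ s, i ≠ ⟨l, q, τ, s⟩) : D.basis.repr (D.rowProj l q x) i = 0 := by
  classical
  suffices h : Finsupp.lapply i ∘ₗ D.basis.repr.toLinearMap ∘ₗ D.rowProj l q = 0 from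
    LinearMap.congr_fun h x
  refine D.basis.ext fun j => ?_
  simp only [rowProj, LinearMap.comp_apply, Module.Basis.constr_basis]
  split_ifs with h
  · obtain ⟨τ, s, rfl⟩ := h
    simpa using Finsupp.single_eq_of_ne (hi τ s)
  · simp

theorem rowProj_mem {X : Set Λ} {l : Λ} (hl : l ∈ X) (q : S l) (x : A) :
    D.rowProj l q x ∈ cellSpan R D.C X := by
  rw [mem_cellSpan_iff]
  rintro k hk p σ s
  refine D.repr_rowProj_eq_zero l q x fun τ s h => hk ?_
  obtain rfl : k = l := congrArg Sigma.fst h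
  exact hl

theorem rowProj_eq_zero {l : Λ} {q : S l} {x : A}
    (hx : ∀ τ s, D.basis.repr x ⟨l, q, τ, s⟩ = 0) : D.rowProj l q x = 0 := by
  refine D.basis.ext_elem fun i => ?_
  rw [map_zero, Finsupp.zero_apply]
  by_cases hi : ∃ τ s, i = ⟨l, q, τ, s⟩
  · obtain ⟨τ, s, rfl⟩ := hi
    rw [repr_rowProj, hx]
  · push Not at hi
    exact D.repr_rowProj_eq_zero l q x hi

theorem rowProj_eq_zero_of_mem {X : Set Λ} {l : Λ} (hl : l ∉ X) (q : S l) {x : A}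
    (hx : x ∈ cellSpan R D.C X) : D.rowProj l q x = 0 :=
  D.rowProj_eq_zero fun τ s => D.repr_eq_zero hx hl q τ s

theorem rowProj_C_mul_of_ne {l : Λ} {p q : S l} (h : p ≠ q) (τ : G l) (s : S l) (b : A) :
    D.rowProj l q (D.C l p τ s * b) = 0 :=
  D.rowProj_eq_zero fun _ _ => D.repr_C_mul_of_ne l b τ s _ _ h.symm

theorem rowProj_C_of_ne {l : Λ} {p q : S l} (h : p ≠ q) (τ : G l) (s : S l) :
    D.rowProj l q (D.C l p τ s) = 0 := by
  simpa using D.rowProj_C_mul_of_ne h τ s 1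

theorem rowProj_C_self (l : Λ) (q : S l) (τ : G l) (s : S l) :
    D.rowProj l q (D.C l q τ s) = D.C l q τ s := by
  have h := D.basis_apply ⟨l, q, τ, s⟩
  rw [← h, rowProj, Module.Basis.constr_basis, if_pos ⟨τ, s, rfl⟩]

/-! ### The rows of the cell `l` as right modules modulo `I_Y`. -/

variable {Y Z : LowerSet Λ} {l : Λ}

/-- Within the cell `l` the product has components in row `q` only, and the rest of `I_Z` is already
`I_Y`. -/
theorem rowProj_C_mul_self_sub_mem (hl : l ∈ Z) (hZ : ∀ k ∈ Z, k ∈ Y ∨ k = l) (q : S l) (τ : G l)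
    (s : S l) (b : A) :
    D.rowProj l q (D.C l q τ s * b) - D.C l q τ s * b ∈ D.ideal Y := by
  rw [mem_ideal, mem_cellSpan_iff]
  intro k hk p' ρ s'
  by_cases hkl : k = l
  · subst hkl
    rw [map_sub, Finsupp.sub_apply, sub_eq_zero]
    by_cases hp : p' = q
    · rw [hp, repr_rowProj]
    · rw [D.repr_C_mul_of_ne _ _ _ _ _ _ hp, repr_rowProj_eq_zero]
      intro τ s h
      simp_all
  · have hC : D.C l q τ s ∈ D.ideal Z := Submodule.subset_span ⟨l, hl, q, τ, s, rfl⟩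
    have h : D.rowProj l q (D.C l q τ s * b) - D.C l q τ s * b ∈ D.ideal Z :=
      sub_mem (D.rowProj_mem hl q _) (Ideal.mul_mem_right b _ hC)
    exact D.repr_eq_zero h (fun hk' => (hZ k hk').elim hk hkl) _ _ _

/-- Right linearity of the row projection modulo `I_Y`. It is restricted to `I_Z` because multiples
of elements from other cells may acquire components in the cell `l`. -/
theorem rowProj_mul_sub_mem (hl : l ∈ Z) (hlY : l ∉ Y) (hZ : ∀ k ∈ Z, k ∈ Y ∨ k = l) (q : S l)
    {z : A} (hz : z ∈ D.ideal Z) (b : A) :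
    D.rowProj l q (z * b) - D.rowProj l q z * b ∈ D.ideal Y := by
  rw [mem_ideal] at hz
  induction hz using Submodule.span_induction with
  | mem x hx =>
    obtain ⟨k, hk, p, τ, s, rfl⟩ := hx
    obtain hkY | rfl := hZ k hk
    · have hC : D.C k p τ s ∈ D.ideal Y := Submodule.subset_span ⟨k, hkY, p, τ, s, rfl⟩
      rw [D.rowProj_eq_zero_of_mem hlY q hC,
        D.rowProj_eq_zero_of_mem hlY q (Ideal.mul_mem_right b _ hC)]
      simp
    · by_cases hp : p = q
      · subst hp
        rw [rowProj_C_self]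
        exact D.rowProj_C_mul_self_sub_mem hl hZ p τ s b
      · rw [D.rowProj_C_mul_of_ne hp, D.rowProj_C_of_ne hp]
        simp
  | zero => simp
  | add x y _ _ hx hy =>
    convert add_mem hx hy using 1
    simp only [add_mul, map_add]
    abel
  | smul c x _ hx =>
    convert Submodule.smul_mem (cellSpan R D.C (Y : Set Λ)) c hx using 1
    simp [smul_sub, mem_ideal]

/-- On a generator in row `p` only the term `q = p` survives, where the row element is a left
identity modulo `I_{<l}`, which is contained in `I_Y`. -/
theorem sum_rowElement_mul_rowProj_sub_mem (hlY : l ∉ Y) (hZ : ∀ k ∈ Z, k ∈ Y ∨ k = l)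
    (hlt : Set.Iio l ⊆ Y) {σ : S l → G l} {v : S l → D.LinkModule l}
    (h₁ : ∀ q, D.form l (σ q) (D.linkC l q) (v q) = 1)
    (h₀ : ∀ q, ∀ τ : G l, τ ≠ σ q → D.form l τ (D.linkC l q) (v q) = 0)
    {z : A} (hz : z ∈ D.ideal Z) :
    ∑ q, D.rowElement l q (σ q) (v q) * D.rowProj l q z - z ∈ D.ideal Y := by
  rw [mem_ideal] at hz
  induction hz using Submodule.span_induction with
  | mem x hx =>
    obtain ⟨k, hk, p, τ, s, rfl⟩ := hx
    obtain hkY | rfl := hZ k hk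
    · have hC : D.C k p τ s ∈ D.ideal Y := Submodule.subset_span ⟨k, hkY, p, τ, s, rfl⟩
      simpa [D.rowProj_eq_zero_of_mem hlY _ hC] using hC
    · rw [Finset.sum_eq_single p (fun q _ hq => by rw [D.rowProj_C_of_ne hq.symm, mul_zero])
        (by simp), rowProj_C_self]
      exact Submodule.span_mono (by rintro _ ⟨j, hj, h⟩; exact ⟨j, hlt hj, h⟩)
        (D.rowElement_mul_C (h₁ p) (h₀ p) τ s)
  | zero => simp
  | add x y _ _ hx hy =>
    convert add_mem hx hy using 1
    simp only [mul_add, map_add, Finset.sum_add_distrib]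
    abel
  | smul c x _ hx =>
    convert Submodule.smul_mem (cellSpan R D.C (Y : Set Λ)) c hx using 1
    simp [smul_sub, Finset.smul_sum, mem_ideal]

/-- The projection onto a row, modulo `I_Y`. -/
def rowProjQuotient (hlY : l ∉ Y) (q : S l) : A ⧸ D.ideal Y →+ A ⧸ D.ideal Y :=
  QuotientAddGroup.map _ _ (D.rowProj l q).toAddMonoidHom fun x hx => by
    change D.rowProj l q x ∈ D.ideal Y
    rw [D.rowProj_eq_zero_of_mem hlY q hx]
    exact zero_mem _

theorem rowProjQuotient_mk (hlY : l ∉ Y) (q : S l) (x : A) :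
    D.rowProjQuotient hlY q (Ideal.Quotient.mk _ x) = Ideal.Quotient.mk _ (D.rowProj l q x) :=
  rfl

/-- The kernel here is `I_Z/I_Y`, and the last two fields are the preceding congruences read modulo
`I_Y`. -/
theorem isRightDualBasis (hYZ : Y ≤ Z) (hl : l ∈ Z) (hlY : l ∉ Y) (hZ : ∀ k ∈ Z, k ∈ Y ∨ k = l)
    (hlt : Set.Iio l ⊆ Y) {σ : S l → G l} {v : S l → D.LinkModule l}
    (h₁ : ∀ q, D.form l (σ q) (D.linkC l q) (v q) = 1)
    (h₀ : ∀ q, ∀ τ : G l, τ ≠ σ q → D.form l τ (D.linkC l q) (v q) = 0) :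
    IsRightDualBasis (RingHom.ker (Ideal.Quotient.factor (D.ideal_mono hYZ)))
      (fun q => Ideal.Quotient.mk _ (D.rowElement l q (σ q) (v q)))
      (D.rowProjQuotient hlY) where
  mem q := Ideal.Quotient.eq_zero_iff_mem.mpr (D.rowElement_mem hl _ _ _)
  coord_mem q j _ := by
    obtain ⟨z, rfl⟩ := Ideal.Quotient.mk_surjective j
    exact Ideal.Quotient.eq_zero_iff_mem.mpr (D.rowProj_mem hl _ _)
  coord_mul q j hj b := by
    obtain ⟨z, rfl⟩ := Ideal.Quotient.mk_surjective j
    obtain ⟨b, rfl⟩ := Ideal.Quotient.mk_surjective b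
    exact Ideal.Quotient.eq.mpr
      (D.rowProj_mul_sub_mem hl hlY hZ q (Ideal.Quotient.eq_zero_iff_mem.mp hj) b)
  sum_eq j hj := by
    obtain ⟨z, rfl⟩ := Ideal.Quotient.mk_surjective j
    simp only [rowProjQuotient_mk, ← map_mul, ← map_sum]
    exact Ideal.Quotient.eq.mpr (D.sum_rowElement_mul_rowProj_sub_mem hlY hZ hlt h₁ h₀
      (Ideal.Quotient.eq_zero_iff_mem.mp hj))

end NaiveCellular

end CellIdeals

/-! ### Comparison of `Tor` over cell quotients -/

section CellTor

variable {R : Type uR} [CommRing R] {A : Type uA} [Ring A] [Algebra R A]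
  {Λ : Type uΛ} [PartialOrder Λ] {G : Λ → Type uG} [∀ l, Group (G l)]
  {S : Λ → Type uS} [∀ l, Fintype (S l)] (D : NaiveCellular R A G S)

namespace NaiveCellular

/-- Enlarging the downward closed set `Y` by one element `l` that satisfies the condition on the
bilinear forms does not change `Tor`. -/
theorem algebraTor_iso_of_insert {Y Z : LowerSet Λ} {l : Λ} (hYZ : Y ≤ Z) (hl : l ∈ Z)
    (hlY : l ∉ Y) (hZ : ∀ k ∈ Z, k ∈ Y ∨ k = l) (hlt : Set.Iio l ⊆ Y)
    (hform : ∀ q : S l, ∃ v : D.LinkModule l, ∃ σ : G l,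
      D.form l σ (D.linkC l q) v = 1 ∧ ∀ τ : G l, τ ≠ σ → D.form l τ (D.linkC l q) v = 0)
    (M : Type uM) [AddCommGroup M] [Module Aᵐᵒᵖ M]
    (N : Type (max uA v)) [AddCommGroup N] [Module A N]
    (hM : ∀ a ∈ D.ideal Z, ∀ m : M, op a • m = 0)
    (hN : ∀ a ∈ D.ideal Z, ∀ n : N, a • n = 0) (n : ℕ) :
    Nonempty
      (algebraTor R
          (rightModuleQuotient (D.ideal Y) M fun a ha => hM a (D.ideal_mono hYZ ha))
          (leftModuleQuotient (D.ideal Y) N fun a ha => hN a (D.ideal_mono hYZ ha)) n ≃ₗ[R]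
        algebraTor R (rightModuleQuotient (D.ideal Z) M hM)
          (leftModuleQuotient (D.ideal Z) N hN) n) := by
  choose v σ h₁ h₀ using hform
  let f : A ⧸ D.ideal Y →ₐ[R] A ⧸ D.ideal Z :=
    { Ideal.Quotient.factor (D.ideal_mono hYZ) with commutes' := fun _ => rfl }
  refine algebraTor_iso_of_isRightDualBasis f (Ideal.Quotient.factor_surjective (D.ideal_mono hYZ))
    (M := rightModuleQuotient (D.ideal Y) M fun a ha => hM a (D.ideal_mono hYZ ha))
    (M' := rightModuleQuotient (D.ideal Z) M hM) (AddEquiv.refl M) (fun b m => ?_)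
    (D.isRightDualBasis hYZ hl hlY hZ hlt h₁ h₀)
    (N := leftModuleQuotient (D.ideal Y) N fun a ha => hN a (D.ideal_mono hYZ ha))
    (N' := leftModuleQuotient (D.ideal Z) N hN) (AddEquiv.refl N) (fun b m => ?_) n
  · obtain ⟨a, rfl⟩ := Ideal.Quotient.mk_surjective b
    rfl
  · obtain ⟨a, rfl⟩ := Ideal.Quotient.mk_surjective b
    rfl

end NaiveCellular

end CellTor

end

/-! ### Induction on the number of cells in `X \ Y`. -/

theorem theorem1p1
    {R : Type uR} [CommRing R] {A : Type uA} [Ring A] [Algebra R A]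
    {Λ : Type uΛ} [PartialOrder Λ] {G : Λ → Type uG} [∀ l, Group (G l)]
    {S : Λ → Type uS} [∀ l, Fintype (S l)]
    (D : NaiveCellular R A G S)
    (X Y : LowerSet Λ) (hYX : Y ≤ X) (hfin : ((X : Set Λ) \ (Y : Set Λ)).Finite)
    (hform : ∀ l ∈ (X : Set Λ) \ (Y : Set Λ), ∀ q : S l, ∃ v : D.LinkModule l, ∃ σ : G l,
      D.form l σ (D.linkC l q) v = 1 ∧ ∀ τ : G l, τ ≠ σ → D.form l τ (D.linkC l q) v = 0)
    (M : Type uM) [AddCommGroup M] [Module Aᵐᵒᵖ M]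
    (N : Type (max uA v)) [AddCommGroup N] [Module A N]
    (hM : ∀ a ∈ D.ideal X, ∀ m : M, op a • m = 0)
    (hN : ∀ a ∈ D.ideal X, ∀ n : N, a • n = 0)
    (n : ℕ) :
    Nonempty
      (algebraTor R
          (rightModuleQuotient (D.ideal Y) M fun a ha => hM a (D.ideal_mono hYX ha))
          (leftModuleQuotient (D.ideal Y) N fun a ha => hN a (D.ideal_mono hYX ha)) n ≃ₗ[R]
        algebraTor R
          (rightModuleQuotient (D.ideal X) M hM)
          (leftModuleQuotient (D.ideal X) N hN) n) := by
  obtain ⟨m, hm⟩ : ∃ m, m = ((X : Set Λ) \ (Y : Set Λ)).ncard := ⟨_, rfl⟩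
  induction m generalizing Y with
  | zero =>
    obtain rfl : Y = X :=
      le_antisymm hYX (Set.sdiff_eq_empty.mp ((Set.ncard_eq_zero hfin).mp hm.symm))
    exact ⟨LinearEquiv.refl R _⟩
  | succ m ih =>
    -- Minimality puts everything strictly below `l` into `Y`, so `Y ∪ {l}` is downward closed and
    -- `I_{<l} ⊆ I_Y`.
    obtain ⟨l, hl, hmin⟩ := hfin.exists_minimal ((Set.ncard_pos hfin).mp (by omega))
    have hlt : Set.Iio l ⊆ (Y : Set Λ) := fun k hk => by
      by_contra hkY
      exact hk.not_ge (hmin ⟨X.lower hk.le hl.1, hkY⟩ hk.le)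
    let Z : LowerSet Λ := Y ⊔ LowerSet.Iic l
    have hlZ : l ∈ Z := Or.inr le_rfl
    have hZX : Z ≤ X := sup_le hYX (LowerSet.Iic_le.mpr hl.1)
    have hZ : ∀ k ∈ Z, k ∈ Y ∨ k = l := fun k hk =>
      hk.elim Or.inl fun hkl => (eq_or_lt_of_le hkl).symm.imp_left fun h => hlt h
    have hsub : (X : Set Λ) \ Z ⊆ (X : Set Λ) \ Y := Set.sdiff_subset_sdiff_right le_sup_left
    have hdiff : (X : Set Λ) \ Z = ((X : Set Λ) \ Y) \ {l} := by
      refine Set.ext fun k => ⟨fun hk => ⟨hsub hk, fun h => hk.2 (h ▸ hlZ)⟩, fun hk => ⟨hk.1.1, ?_⟩⟩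
      exact fun h => (hZ k h).elim hk.1.2 hk.2
    obtain ⟨α⟩ := D.algebraTor_iso_of_insert le_sup_left hlZ hl.2 hZ hlt (hform l hl) M N
      (fun a ha => hM a (D.ideal_mono hZX ha)) (fun a ha => hN a (D.ideal_mono hZX ha)) n
    -- The pair `Z ≤ X` has one cell fewer, and its cells still satisfy the form condition.
    obtain ⟨β⟩ := ih Z hZX (hfin.subset hsub) (fun k hk => hform k (hsub hk)) (by
      rw [hdiff, Set.ncard_sdiff_singleton_of_mem hl]
      omega)
    exact ⟨α.trans β⟩
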